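/- Let $K$ be a field of characteristic $0$ and let $\mathbb{A}_K^n=K^n$. By an affine variety over $K$ we mean the common zero set in some $\mathbb{A}_K^n$ of a collection of polynomials in $K[x_1,\dots,x_n]$ (not necessarily irreducible). An automorphism of an affine variety $Y\subseteq\mathbb{A}_K^n$ is a bijection $\sigma:Y\to Y$ such that both $\sigma$ and $\sigma^{-1}$ are given by the restriction to $Y$ of an $n$-tuple of polynomials in $K[x_1,\dots,x_n]$. **Theorem.** Let $Y\subseteq\mathbb{A}_K^n$ be an affine variety over $K$, let $\sigma$ be an automorphism of $Y$, let $\mathbf{q}$ be a point of $Y$, and let $X\subseteq Y$ be a subvariety, that is, an affine variety in $\mathbb{A}_K^n$ contained in $Y$. Then the set $$\{m\in\mathbb{Z} : \sigma^m(\mathbf{q})\in X\}$$ is the union of a finite set and finitely many complete doubly-infinite arithmetic progressions, that is, sets of the form $\{a+dk : k\in\mathbb{Z}\}$ with $a,d\in\mathbb{Z}$ and $d\geq 1$. -/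

import Mathlib

namespace AffineOrbit

/-- A subset of affine space `K ^ n` is an affine variety (not necessarily irreducible) if it is
the common zero set in `K ^ n` of an ideal of polynomials with coefficients in `K`. -/
def IsAffineVariety {K : Type*} [Field K] {n : ℕ} (Y : Set (Fin n → K)) : Prop :=
  ∃ I : Ideal (MvPolynomial (Fin n) K), Y = MvPolynomial.zeroLocus K I

/-- A map between subsets of affine spaces is a morphism (a regular map) if its coordinates are
restrictions of polynomials with coefficients in `K`. -/
def IsMorphism {K : Type*} [Field K] {n m : ℕ} {Y : Set (Fin n → K)} {Z : Set (Fin m → K)}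
    (f : Y → Z) : Prop :=
  ∃ F : Fin m → MvPolynomial (Fin n) K,
    ∀ (y : Y) (i : Fin m), (f y : Fin m → K) i = MvPolynomial.eval (y : Fin n → K) (F i)

/-- An automorphism of a variety `Y` is a bijection of `Y` onto itself such that it and its inverse
are both morphisms. -/
def IsAutomorphism {K : Type*} [Field K] {n : ℕ} {Y : Set (Fin n → K)}
    (σ : Equiv.Perm Y) : Prop :=
  IsMorphism (σ : Y → Y) ∧ IsMorphism (σ.symm : Y → Y)

/-- A complete doubly-infinite arithmetic progression `{a + d k : k ∈ ℤ}` with positive common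
difference `d`. -/
def IsDoublyInfiniteProgression (P : Set ℤ) : Prop :=
  ∃ a d : ℤ, 0 < d ∧ P = Set.range (fun k : ℤ => a + d * k)

end AffineOrbit

/-!
Only the recurrence satisfied by the orbit matters: `u m = σ ^ m q` satisfies `u (m + 1) = F (u m)`
and `u (m - 1) = G (u m)` for tuples of polynomials `F` and `G`, and the set in question is the set
of common zeros of finitely many polynomials along `u`. The proof is the `p`-adic method of Skolem,
Mahler and Lech.

All the data lie in a finitely generated subring of `K`. For a suitable odd prime `p` this subring
embeds in the integral closure of `ℤ_[p]` in an algebraic closure of `ℚ_[p]`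
(`exists_padic_embedding`), with image in a ring `D` which is finite as a module over `ℤ_[p]`, so
that `D / p` is finite.

Modulo `p` the orbit is periodic (`IsShiftStable.exists_period`). On a residue class modulo a period
it is `v = v 0 + p * y`, and in the coordinates `y` the shift is affine modulo `p`
(`reindex_mem_affineMod`). Let `B` be the algebra of polynomial expressions in `y`, viewed as
functions on `ℤ`. The shift is an automorphism of `B`, because it and its inverse are polynomial
along the orbit. Being affine modulo `p`, its powers act on the generators of `B` in finitely many
ways modulo `p * B`, so some power acts trivially on `B / p * B` (`exists_shift_sub_mem`). It is here
that invertibility of `σ` is needed; neither an extension of `σ` to affine space nor smoothness of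
`Y` plays a role.

On a residue class for this power, the difference operator maps the algebra of polynomial
expressions into `p` times itself, so the `j`-th differences of each member `g` are divisible by
`p ^ j`. Hence the Newton coefficients `Δ ^ j g 0 / j!` tend to `0`, `p` being odd, and the analogue
of Strassmann's theorem for Newton series (`IsLastMax.finite_zeros`) shows that `g` vanishes
identically or has finitely many zeros. Each residue class therefore contributes either a full
progression or a finite set (`IsShiftStable.isProgressionUnion`).
-/

namespace AffineOrbit

open Filter Topology

/-! ### Newton series over an ultrametric field -/

/-- The value at `k` of the Newton series `∑ j, c j * k * (k - 1) * ⋯ * (k - j + 1)`. -/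
noncomputable def newtonEval {C : Type*} [Field C] (c : ℕ → C) (k : ℕ) : C :=
  ∑ j ∈ Finset.range (k + 1), c j * (k.descFactorial j : C)

/-- The coefficients of the Newton series translated by one. -/
def newtonShift {C : Type*} [Field C] (c : ℕ → C) (j : ℕ) : C :=
  c j + ((j + 1 : ℕ) : C) * c (j + 1)

section Newton

variable {C : Type*} [Field C]

theorem newtonEval_zero (c : ℕ → C) : newtonEval c 0 = c 0 := by
  simp [newtonEval]

theorem newtonEval_succ (c : ℕ → C) (k : ℕ) :
    newtonEval c (k + 1) = newtonEval (newtonShift c) k := by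
  have h1 : newtonEval c k =
      ∑ j ∈ Finset.range (k + 1), c (j + 1) * (k.descFactorial (j + 1) : C) + c 0 := by
    have := Finset.sum_range_succ (fun j => c j * (k.descFactorial j : C)) (k + 1)
    rw [Finset.sum_range_succ'] at this
    rw [newtonEval]
    simpa [Nat.descFactorial_of_lt (Nat.lt_succ_self k)] using this.symm
  have h2 : newtonEval (newtonShift c) k = newtonEval c k +
      ∑ j ∈ Finset.range (k + 1), ((j + 1 : ℕ) : C) * c (j + 1) * (k.descFactorial j : C) := by
    simp only [newtonEval, newtonShift, add_mul, Finset.sum_add_distrib]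
  rw [h2, h1, newtonEval, Finset.sum_range_succ', add_right_comm, ← Finset.sum_add_distrib]
  simp only [Nat.descFactorial_zero, Nat.cast_one, mul_one, add_left_inj]
  refine Finset.sum_congr rfl fun j hj => ?_
  have hj : j ≤ k := Nat.lt_succ_iff.mp (Finset.mem_range.mp hj)
  rw [Nat.succ_descFactorial_succ, Nat.descFactorial_succ]
  push_cast [Nat.cast_sub hj]
  ring

theorem newtonEval_add (c : ℕ → C) (m k : ℕ) :
    newtonEval c (k + m) = newtonEval (newtonShift^[m] c) k := by
  induction m generalizing c with
  | zero => rfl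
  | succ m ih => rw [← add_assoc, newtonEval_succ, ih, Function.iterate_succ_apply]

/-- A Newton series that vanishes at the origin is divided by its variable, after a translation by
one, by shifting its coefficients. -/
theorem newtonEval_succ_of_zero (c : ℕ → C) (h : c 0 = 0) (k : ℕ) :
    newtonEval c (k + 1) = ((k + 1 : ℕ) : C) * newtonEval (fun j => c (j + 1)) k := by
  rw [newtonEval, Finset.sum_range_succ', h, zero_mul, add_zero, newtonEval, Finset.mul_sum]
  refine Finset.sum_congr rfl fun j _ => ?_
  rw [Nat.succ_descFactorial_succ]
  push_cast
  ring

/-- Newton's interpolation formula. -/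
theorem newtonEval_fwdDiff [CharZero C] (f : ℕ → C) (k : ℕ) :
    newtonEval (fun j => (fwdDiff 1)^[j] f 0 / (j.factorial : C)) k = f k := by
  have h := shift_eq_sum_fwdDiff_iter 1 f k 0
  simp only [smul_eq_mul, mul_one, zero_add] at h
  rw [h, newtonEval]
  refine Finset.sum_congr rfl fun j _ => ?_
  have : (j.factorial : C) ≠ 0 := by exact_mod_cast j.factorial_ne_zero
  rw [Nat.descFactorial_eq_factorial_mul_choose, nsmul_eq_mul]
  push_cast
  field_simp

end Newton

/-- The coefficient `c N` has the largest absolute value, and `N` is the last index with this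
property. -/
def IsLastMax {C : Type*} [NormedField C] (c : ℕ → C) (N : ℕ) : Prop :=
  (∀ i, ‖c i‖ ≤ ‖c N‖) ∧ ∀ i, N < i → ‖c i‖ < ‖c N‖

section Strassmann

variable {C : Type*} [NormedField C]

theorem exists_isLastMax {c : ℕ → C} (hc : Tendsto c atTop (𝓝 0)) (h0 : ∃ i, c i ≠ 0) :
    ∃ N, IsLastMax c N := by
  obtain ⟨i, hi⟩ := h0
  have hfin : {j | ‖c i‖ ≤ ‖c j‖}.Finite := by
    have := (tendsto_zero_iff_norm_tendsto_zero.mp hc).eventually_lt_const (norm_pos_iff.mpr hi)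
    rw [← Nat.cofinite_eq_atTop, Filter.eventually_cofinite] at this
    simpa using this
  -- Maximizing `(‖c j‖, j)` lexicographically picks the last index among those of maximal norm.
  obtain ⟨N, hN, hmax⟩ := Set.exists_max_image _ (fun j => toLex (‖c j‖, j)) hfin ⟨i, le_refl ‖c i‖⟩
  have key : ∀ j, ‖c j‖ < ‖c N‖ ∨ ‖c j‖ = ‖c N‖ ∧ j ≤ N := by
    intro j
    by_cases hj : ‖c i‖ ≤ ‖c j‖
    · exact Prod.Lex.toLex_le_toLex.mp (hmax j hj)
    · exact Or.inl ((not_le.mp hj).trans_le hN)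
  refine ⟨N, fun j => ?_, fun j hj => ?_⟩
  · rcases key j with h | h
    exacts [h.le, h.1.le]
  · rcases key j with h | h
    exacts [h, absurd h.2 (not_le.mpr hj)]

variable [IsUltrametricDist C]

theorem IsLastMax.shift {c : ℕ → C} {N : ℕ} (h : IsLastMax c N) :
    IsLastMax (newtonShift c) N := by
  have hs : ∀ j, ‖((j + 1 : ℕ) : C) * c (j + 1)‖ ≤ ‖c (j + 1)‖ := fun j => by
    rw [norm_mul]
    exact mul_le_of_le_one_left (norm_nonneg _) (IsUltrametricDist.norm_natCast_le_one C _)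
  have hN : ‖newtonShift c N‖ = ‖c N‖ := by
    have hlt := (hs N).trans_lt (h.2 _ N.lt_succ_self)
    rw [newtonShift, IsUltrametricDist.norm_add_eq_max_of_norm_ne_norm hlt.ne', max_eq_left hlt.le]
  refine ⟨fun i => ?_, fun i hi => ?_⟩
  · rw [hN]
    exact (IsUltrametricDist.norm_add_le_max _ _).trans (max_le (h.1 i) ((hs i).trans (h.1 _)))
  · rw [hN]
    exact (IsUltrametricDist.norm_add_le_max _ _).trans_lt
      (max_lt (h.2 i hi) ((hs i).trans_lt (h.2 _ (hi.trans i.lt_succ_self))))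

theorem IsLastMax.shift_iterate {c : ℕ → C} {N : ℕ} (h : IsLastMax c N) (m : ℕ) :
    IsLastMax (newtonShift^[m] c) N := by
  induction m generalizing c with
  | zero => exact h
  | succ m ih => exact ih h.shift

/-- Strassmann's theorem for Newton series, at natural arguments: a zero can be translated to the
origin and then divided out, which lowers the last index of maximal absolute value by one. -/
theorem IsLastMax.finite_zeros [CharZero C] {c : ℕ → C} {N : ℕ} (h : IsLastMax c N) :
    {k : ℕ | newtonEval c k = 0}.Finite := by
  induction N generalizing c with
  | zero =>
    refine Set.Finite.subset Set.finite_empty fun m hm => ?_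
    have h' := h.shift_iterate m
    have h0 : newtonEval c (0 + m) = 0 := by rw [zero_add]; exact hm
    rw [newtonEval_add, newtonEval_zero] at h0
    have := h'.2 1 one_pos
    rw [h0, norm_zero] at this
    exact absurd this (not_lt.mpr (norm_nonneg _))
  | succ N ih =>
    rcases Set.eq_empty_or_nonempty {k : ℕ | newtonEval c k = 0} with he | ⟨m, hm⟩
    · rw [he]; exact Set.finite_empty
    have h' := h.shift_iterate m
    have h0 : newtonEval c (0 + m) = 0 := by rw [zero_add]; exact hm
    rw [newtonEval_add, newtonEval_zero] at h0
    set d := newtonShift^[m] c with hd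
    have h1 : IsLastMax (fun j => d (j + 1)) N :=
      ⟨fun i => h'.1 _, fun i hi => h'.2 _ (Nat.succ_lt_succ hi)⟩
    refine ((Set.finite_Iio (m + 1)).union ((ih h1).image fun k => k + 1 + m)).subset ?_
    intro k hk
    rcases lt_or_ge k (m + 1) with hlt | hge
    · exact Or.inl hlt
    · obtain ⟨l, rfl⟩ := Nat.exists_eq_add_of_le hge
      refine Or.inr ⟨l, ?_, by ring⟩
      have hk' : newtonEval c (l + 1 + m) = 0 := by
        rw [show l + 1 + m = m + 1 + l by ring]; exact hk
      rw [newtonEval_add, ← hd, newtonEval_succ_of_zero _ h0] at hk'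
      exact (mul_eq_zero.mp hk').resolve_left (by exact_mod_cast l.succ_ne_zero)

end Strassmann

section Padic

variable (p : ℕ) [hp : Fact p.Prime]

theorem tendsto_norm_p_pow_div_factorial (h2 : p ≠ 2) :
    Tendsto (fun j : ℕ => ‖(p : PadicAlgCl p)‖ ^ j / ‖(j.factorial : PadicAlgCl p)‖)
      atTop (𝓝 0) := by
  have hp3 : 3 ≤ p := by
    have := hp.out.two_le
    omega
  have hnorm : ∀ m : ℕ, ‖(m : PadicAlgCl p)‖ = ‖(m : ℚ_[p])‖ := fun m => by
    rw [← PadicAlgCl.norm_extends, map_natCast]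
  have hp0 : (0 : ℝ) < p := by exact_mod_cast hp.out.pos
  have hlt : ((p : ℝ)⁻¹) < 1 := inv_lt_one_of_one_lt₀ (by exact_mod_cast hp.out.one_lt)
  have hlim : Tendsto (fun j : ℕ => ((p : ℝ)⁻¹) ^ (j / 2)) atTop (𝓝 0) :=
    (tendsto_pow_atTop_nhds_zero_of_lt_one (inv_nonneg.mpr hp0.le) hlt).comp
      (Nat.tendsto_div_const_atTop two_ne_zero)
  refine squeeze_zero (fun j => by positivity) (fun j => ?_) hlim
  -- Legendre's formula with `p - 1 ≥ 2` bounds the valuation of `j!` by `j / 2`.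
  have hv : 2 * padicValNat p j.factorial ≤ j := by
    have h := sub_one_mul_padicValNat_factorial (p := p) j
    have h' : 2 * padicValNat p j.factorial ≤ (p - 1) * padicValNat p j.factorial :=
      Nat.mul_le_mul_right _ (by omega)
    omega
  have hfac : ‖(j.factorial : ℚ_[p])‖ = ((p : ℝ)⁻¹) ^ padicValNat p j.factorial := by
    rw [Padic.norm_eq_zpow_neg_valuation (by exact_mod_cast j.factorial_ne_zero),
      Padic.valuation_natCast, zpow_neg, zpow_natCast, inv_pow]
  rw [hnorm, hnorm, Padic.norm_p, hfac, div_le_iff₀ (by positivity), ← pow_add]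
  exact pow_le_pow_of_le_one (inv_nonneg.mpr hp0.le) hlt.le (by omega)

/-- A function on `ℕ` whose `j`-th differences at the origin are divisible by `p ^ j`, with `p` odd,
has finitely many zeros unless it vanishes identically. -/
theorem finite_zeros_nat (h2 : p ≠ 2) (f : ℕ → PadicAlgCl p)
    (hf : ∀ j, ‖(fwdDiff 1)^[j] f 0‖ ≤ ‖(p : PadicAlgCl p)‖ ^ j) :
    (∀ k, f k = 0) ∨ {k | f k = 0}.Finite := by
  set c : ℕ → PadicAlgCl p := fun j => (fwdDiff 1)^[j] f 0 / (j.factorial : PadicAlgCl p) with hc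
  have hcf : ∀ k, newtonEval c k = f k := newtonEval_fwdDiff f
  have hlim : Tendsto c atTop (𝓝 0) := by
    refine squeeze_zero_norm (fun j => ?_) (tendsto_norm_p_pow_div_factorial p h2)
    rw [hc, norm_div]
    exact div_le_div_of_nonneg_right (hf j) (norm_nonneg _)
  by_cases h0 : ∃ i, c i ≠ 0
  · obtain ⟨N, hN⟩ := exists_isLastMax hlim h0
    right
    simpa only [hcf] using hN.finite_zeros
  · push Not at h0
    left
    intro k
    rw [← hcf, newtonEval]
    simp [h0]

end Padic

/-! ### Finite unions of arithmetic progressions -/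

/-- A set of integers is a union of finitely many complete arithmetic progressions and a finite
set. -/
def IsProgressionUnion (Z : Set ℤ) : Prop :=
  ∃ (𝒜 : Set (Set ℤ)) (T : Set ℤ),
    𝒜.Finite ∧ (∀ P ∈ 𝒜, IsDoublyInfiniteProgression P) ∧ T.Finite ∧ Z = ⋃₀ 𝒜 ∪ T

section ProgressionUnion

theorem isProgressionUnion_of_finite {Z : Set ℤ} (h : Z.Finite) : IsProgressionUnion Z :=
  ⟨∅, Z, Set.finite_empty, by simp, h, by simp⟩

theorem isProgressionUnion_univ : IsProgressionUnion Set.univ := by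
  refine ⟨{Set.univ}, ∅, Set.finite_singleton _, ?_, Set.finite_empty, by simp⟩
  rintro P rfl
  exact ⟨0, 1, one_pos, by ext x; simp⟩

theorem IsProgressionUnion.union {Z W : Set ℤ} (hZ : IsProgressionUnion Z)
    (hW : IsProgressionUnion W) : IsProgressionUnion (Z ∪ W) := by
  obtain ⟨A, T, hA, hA', hT, rfl⟩ := hZ
  obtain ⟨B, U, hB, hB', hU, rfl⟩ := hW
  refine ⟨A ∪ B, T ∪ U, hA.union hB, ?_, hT.union hU, ?_⟩
  · rintro P (h | h)
    exacts [hA' P h, hB' P h]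
  · rw [Set.sUnion_union, Set.union_union_union_comm]

theorem IsProgressionUnion.biUnion {ι : Type*} (s : Finset ι) {Z : ι → Set ℤ}
    (h : ∀ i ∈ s, IsProgressionUnion (Z i)) : IsProgressionUnion (⋃ i ∈ s, Z i) := by
  classical
  induction s using Finset.induction_on with
  | empty => simpa using isProgressionUnion_of_finite Set.finite_empty
  | insert a s _ ih =>
    rw [Finset.set_biUnion_insert]
    exact (h a (Finset.mem_insert_self a s)).union
      (ih fun i hi => h i (Finset.mem_insert_of_mem hi))

theorem IsProgressionUnion.image {Z : Set ℤ} (hZ : IsProgressionUnion Z) (r : ℤ) {N : ℕ}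
    (hN : 0 < N) : IsProgressionUnion ((fun k : ℤ => r + N * k) '' Z) := by
  obtain ⟨A, T, hA, hA', hT, rfl⟩ := hZ
  refine ⟨Set.image (fun k : ℤ => r + N * k) '' A, (fun k : ℤ => r + N * k) '' T, hA.image _, ?_,
    hT.image _, ?_⟩
  · rintro _ ⟨P, hP, rfl⟩
    obtain ⟨a, d, hd, rfl⟩ := hA' P hP
    refine ⟨r + N * a, N * d, by positivity, ?_⟩
    rw [← Set.range_comp]
    congr 1
    ext k
    simp only [Function.comp_apply]
    ring
  · rw [Set.image_union, Set.image_sUnion]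

/-- The property of being a union of progressions and a finite set may be checked on each residue
class of some modulus. -/
theorem isProgressionUnion_of_residues {Z : Set ℤ} {N : ℕ} (hN : 0 < N)
    (h : ∀ r : ℤ, IsProgressionUnion {k : ℤ | r + N * k ∈ Z}) : IsProgressionUnion Z := by
  have hZ : Z = ⋃ r ∈ Finset.Ico (0 : ℤ) N, (fun k : ℤ => r + N * k) '' {k : ℤ | r + N * k ∈ Z} := by
    ext m
    simp only [Finset.mem_Ico, Set.mem_iUnion, Set.mem_image, Set.mem_ofPred_eq, exists_prop]
    constructor
    · intro hm
      refine ⟨m % N, ⟨Int.emod_nonneg _ (by positivity), Int.emod_lt_of_pos _ (by positivity)⟩,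
        m / N, ?_, Int.emod_add_mul_ediv m N⟩
      rwa [Int.emod_add_mul_ediv]
    · rintro ⟨r, -, k, hk, rfl⟩
      exact hk
  rw [hZ]
  exact IsProgressionUnion.biUnion _ fun r _ => (h r).image r hN

end ProgressionUnion

/-! ### Algebras of two-sided sequences stable under the shift -/

section Reindex

variable {D : Type*} [CommRing D]

/-- Precomposition with a map `e : ℤ → ℤ`, on the algebra of two-sided sequences. -/
def reindex (D : Type*) [CommRing D] (e : ℤ → ℤ) : (ℤ → D) →ₐ[D] (ℤ → D) :=
  AlgHom.ofLinearMap (LinearMap.funLeft D D e) rfl fun _ _ => rfl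

@[simp]
theorem reindex_apply (e : ℤ → ℤ) (f : ℤ → D) (k : ℤ) : reindex D e f k = f (e k) := rfl

/-- A tuple of two-sided sequences each of whose translates by one, in either direction, is a
polynomial expression in the tuple. -/
def IsShiftStable {ι : Type*} (u : ι → ℤ → D) : Prop :=
  ∀ i, reindex D (· + 1) (u i) ∈ Algebra.adjoin D (Set.range u) ∧
    reindex D (· - 1) (u i) ∈ Algebra.adjoin D (Set.range u)

variable {ι : Type*} {u : ι → ℤ → D}

theorem mem_adjoin_of_algHom (T : (ℤ → D) →ₐ[D] (ℤ → D)) {v : ι → ℤ → D}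
    (h : ∀ i, T (u i) ∈ Algebra.adjoin D (Set.range v)) {f : ℤ → D}
    (hf : f ∈ Algebra.adjoin D (Set.range u)) : T f ∈ Algebra.adjoin D (Set.range v) := by
  have : Algebra.adjoin D (Set.range u) ≤ (Algebra.adjoin D (Set.range v)).comap T := by
    rw [Algebra.adjoin_le_iff]
    rintro _ ⟨i, rfl⟩
    exact h i
  exact this hf

theorem reindex_mem_adjoin (e : ℤ → ℤ) {f : ℤ → D} (hf : f ∈ Algebra.adjoin D (Set.range u)) :
    reindex D e f ∈ Algebra.adjoin D (Set.range fun i => reindex D e (u i)) :=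
  mem_adjoin_of_algHom _ (fun i => Algebra.subset_adjoin ⟨i, rfl⟩) hf

theorem IsShiftStable.add_mem (hu : IsShiftStable u) {f : ℤ → D}
    (hf : f ∈ Algebra.adjoin D (Set.range u)) (N : ℕ) :
    reindex D (· + (N : ℤ)) f ∈ Algebra.adjoin D (Set.range u) := by
  induction N with
  | zero => convert hf using 1; ext k; simp
  | succ N ih =>
    convert mem_adjoin_of_algHom _ (fun i => (hu i).1) ih using 1
    ext k
    simp only [reindex_apply]
    congr 1
    push_cast
    ring

theorem IsShiftStable.sub_mem (hu : IsShiftStable u) {f : ℤ → D}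
    (hf : f ∈ Algebra.adjoin D (Set.range u)) (N : ℕ) :
    reindex D (· - (N : ℤ)) f ∈ Algebra.adjoin D (Set.range u) := by
  induction N with
  | zero => convert hf using 1; ext k; simp
  | succ N ih =>
    convert mem_adjoin_of_algHom _ (fun i => (hu i).2) ih using 1
    ext k
    simp only [reindex_apply]
    congr 1
    push_cast
    ring

theorem IsShiftStable.residue (hu : IsShiftStable u) (r : ℤ) (N : ℕ) :
    IsShiftStable fun i => reindex D (fun k => r + N * k) (u i) := by
  intro i
  have hi : u i ∈ Algebra.adjoin D (Set.range u) := Algebra.subset_adjoin ⟨i, rfl⟩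
  constructor
  · convert reindex_mem_adjoin (fun k => r + N * k) (hu.add_mem hi N) using 1
    ext k
    simp only [reindex_apply]
    congr 1
    ring
  · convert reindex_mem_adjoin (fun k => r + N * k) (hu.sub_mem hi N) using 1
    ext k
    simp only [reindex_apply]
    congr 1
    ring

end Reindex

/-! ### The shift modulo a fixed element -/

section Congruence

variable {D : Type*} [CommRing D] {ι : Type*} {u : ι → ℤ → D} {c : D}

theorem exists_lt_map_eq {α : Type*} [Finite α] (f : ℕ → α) : ∃ a b, a < b ∧ f a = f b := by
  obtain ⟨a, b, hne, h⟩ := Finite.exists_ne_map_eq_of_infinite f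
  rcases hne.lt_or_gt with hlt | hlt
  exacts [⟨a, b, hlt, h⟩, ⟨b, a, hlt, h.symm⟩]

/-- Modulo `c` the sequence runs through a finite set under a map which, on the orbit, is inverted
by another map, so it is periodic. -/
theorem IsShiftStable.exists_period [Finite ι] [Finite (D ⧸ Ideal.span {c})]
    (hu : IsShiftStable u) :
    ∃ N : ℕ, 0 < N ∧ ∀ i m, c ∣ u i (m + N) - u i m := by
  set q := Ideal.Quotient.mk (Ideal.span {c}) with hq
  have hcongr : ∀ m m', (∀ i, q (u i m) = q (u i m')) →
      ∀ f ∈ Algebra.adjoin D (Set.range u), q (f m) = q (f m') := by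
    intro m m' h f hf
    induction hf using Algebra.adjoin_induction with
    | mem _ hx => obtain ⟨i, rfl⟩ := hx; exact h i
    | algebraMap r => rfl
    | add x y _ _ hx hy => simp only [Pi.add_apply, map_add, hx, hy]
    | mul x y _ _ hx hy => simp only [Pi.mul_apply, map_mul, hx, hy]
  obtain ⟨a, b, hab, h⟩ := exists_lt_map_eq fun (m : ℕ) (i : ι) => q (u i m)
  have key : ∀ (t : ℤ) i, q (u i (a + t)) = q (u i (b + t)) := by
    intro t
    induction t using Int.induction_on with
    | zero => intro i; simpa using congrFun h i
    | succ t ih =>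
      intro i
      simpa only [reindex_apply, add_assoc] using hcongr _ _ ih _ (hu i).1
    | pred t ih =>
      intro i
      simpa only [reindex_apply, add_sub_assoc] using hcongr _ _ ih _ (hu i).2
  refine ⟨b - a, Nat.sub_pos_of_lt hab, fun i m => ?_⟩
  have := key (m - a) i
  rw [add_sub_cancel, eq_comm, Ideal.Quotient.eq, Ideal.mem_span_singleton] at this
  rwa [Nat.cast_sub hab.le, show m + ((b : ℤ) - a) = b + (m - a) by ring]

/-- If `v = v 0 + c * y`, every polynomial expression in `v` is, modulo `c ^ 2` times a polynomial
expression in `y`, a constant plus `c` times a linear form in `y`. -/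
theorem exists_linear_expansion {v y : ι → ℤ → D} (hvy : ∀ i k, v i k = v i 0 + c * y i k)
    {f : ℤ → D} (hf : f ∈ Algebra.adjoin D (Set.range v)) :
    ∃ a : D, ∃ l ∈ Submodule.span D (Set.range y), ∃ b ∈ Algebra.adjoin D (Set.range y),
      ∀ k, f k = a + c * l k + c ^ 2 * b k := by
  have hspan : Submodule.span D (Set.range y) ≤
      Subalgebra.toSubmodule (Algebra.adjoin D (Set.range y)) := Algebra.span_le_adjoin D _
  induction hf using Algebra.adjoin_induction with
  | mem _ hx =>
    obtain ⟨i, rfl⟩ := hx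
    refine ⟨v i 0, y i, Submodule.subset_span ⟨i, rfl⟩, 0, zero_mem _, fun k => ?_⟩
    simpa using hvy i k
  | algebraMap r => exact ⟨r, 0, zero_mem _, 0, zero_mem _, fun k => by simp⟩
  | add x y _ _ hx hy =>
    obtain ⟨a, l, hl, b, hb, h⟩ := hx
    obtain ⟨a', l', hl', b', hb', h'⟩ := hy
    refine ⟨a + a', l + l', add_mem hl hl', b + b', add_mem hb hb', fun k => ?_⟩
    simp only [Pi.add_apply, h, h']
    ring
  | mul x y _ _ hx hy =>
    obtain ⟨a, l, hl, b, hb, h⟩ := hx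
    obtain ⟨a', l', hl', b', hb', h'⟩ := hy
    refine ⟨a * a', a • l' + a' • l,
      add_mem (Submodule.smul_mem _ _ hl') (Submodule.smul_mem _ _ hl),
      a • b' + a' • b + l * l' + c • (l * b') + c • (l' * b) + c ^ 2 • (b * b'), ?_, fun k => ?_⟩
    · have hl := hspan hl
      have hl' := hspan hl'
      rw [Subalgebra.mem_toSubmodule] at hl hl'
      exact add_mem (add_mem (add_mem (add_mem (add_mem (Subalgebra.smul_mem _ hb' _)
        (Subalgebra.smul_mem _ hb _)) (mul_mem hl hl')) (Subalgebra.smul_mem _ (mul_mem hl hb') _))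
        (Subalgebra.smul_mem _ (mul_mem hl' hb) _)) (Subalgebra.smul_mem _ (mul_mem hb hb') _)
    · simp only [Pi.mul_apply, Pi.add_apply, Pi.smul_apply, smul_eq_mul, h, h']
      ring

/-- The submodule of the sequences that are affine in `y` modulo `c` times a polynomial expression
in `y`. -/
def affineMod (c : D) (y : ι → ℤ → D) : Submodule D (ℤ → D) :=
  Submodule.span D (insert 1 (Set.range y)) ⊔
    (Subalgebra.toSubmodule (Algebra.adjoin D (Set.range y))).map (c • LinearMap.id)

theorem affineMod_le_adjoin {y : ι → ℤ → D} :
    affineMod c y ≤ Subalgebra.toSubmodule (Algebra.adjoin D (Set.range y)) := by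
  refine sup_le (Submodule.span_le.mpr ?_) ?_
  · rintro _ (rfl | h)
    exacts [one_mem (Algebra.adjoin D (Set.range y)), Algebra.subset_adjoin h]
  · rintro _ ⟨b, hb, rfl⟩
    exact Subalgebra.smul_mem _ hb c

/-- Rescaling `v` around its value at the origin turns the shift into a map which is affine modulo
`c`. -/
theorem reindex_mem_affineMod (hc : IsLeftRegular c) {v y : ι → ℤ → D}
    (hvy : ∀ i k, v i k = v i 0 + c * y i k) {e : ℤ → ℤ} {i : ι}
    (he : reindex D e (v i) ∈ Algebra.adjoin D (Set.range v)) :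
    reindex D e (y i) ∈ affineMod c y := by
  obtain ⟨a, l, hl, b, hb, h⟩ := exists_linear_expansion hvy he
  -- The constant term is the one forced by evaluating the expansion at the origin.
  have heq : reindex D e (y i) = ((y i (e 0) - l 0 - c * b 0) • (1 : ℤ → D) + l) + c • b := by
    ext k
    apply hc
    have h0 := h 0
    have hk := h k
    simp only [reindex_apply] at h0 hk
    rw [hvy i (e 0)] at h0
    rw [hvy i (e k)] at hk
    simp only [reindex_apply, Pi.add_apply, Pi.smul_apply, Pi.one_apply, smul_eq_mul]
    linear_combination hk - h0
  rw [heq]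
  refine Submodule.add_mem_sup (Submodule.mem_span_insert.mpr ⟨_, l, hl, rfl⟩) ⟨b, hb, rfl⟩

/-- The affine map induced by the shift modulo `c` lives in a finite set and the shift is
invertible, so some power of the shift fixes every `y i` modulo `c` times a polynomial expression
in `y`. -/
theorem exists_shift_sub_mem [Finite ι] [Finite (D ⧸ Ideal.span {c})] {y : ι → ℤ → D}
    (hy : IsShiftStable y)
    (hy' : ∀ i, reindex D (· + 1) (y i) ∈ affineMod c y) :
    ∃ M : ℕ, 0 < M ∧ ∀ i, ∃ b ∈ Algebra.adjoin D (Set.range y),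
      ∀ k, y i (k + M) - y i k = c * b k := by
  have := Fintype.ofFinite ι
  have hS : ∀ f ∈ affineMod c y, reindex D (· + 1) f ∈ affineMod c y := by
    suffices affineMod c y ≤ (affineMod c y).comap (reindex D (· + 1)).toLinearMap from this
    refine sup_le (Submodule.span_le.mpr ?_) ?_
    · rintro _ (rfl | ⟨i, rfl⟩)
      · change reindex D (· + 1) 1 ∈ affineMod c y
        rw [map_one]
        exact Submodule.mem_sup_left (Submodule.subset_span (Set.mem_insert _ _))
      · exact hy' i
    · rintro _ ⟨b, hb, rfl⟩
      exact Submodule.mem_sup_right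
        ⟨_, by exact_mod_cast hy.add_mem hb 1, by ext k; simp⟩
  have hpow : ∀ (t : ℕ) i, reindex D (· + (t : ℤ)) (y i) ∈ affineMod c y := by
    intro t i
    induction t with
    | zero =>
      have hi : y i ∈ affineMod c y :=
        Submodule.mem_sup_left
          (Submodule.subset_span (Set.mem_insert_of_mem 1 (Set.mem_range_self i)))
      convert hi using 1
      ext k; simp
    | succ t ih =>
      convert hS _ ih using 1
      ext k
      simp only [reindex_apply]
      congr 1
      push_cast
      ring
  have hexp : ∀ (t : ℕ) i, ∃ (a : D) (l : ι → D), ∃ b ∈ Algebra.adjoin D (Set.range y),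
      ∀ k, y i (k + t) = a + ∑ j, l j * y j k + c * b k := by
    intro t i
    obtain ⟨w, hw, _, ⟨b, hb, rfl⟩, h⟩ := Submodule.mem_sup.mp (hpow t i)
    obtain ⟨a, z, hz, rfl⟩ := Submodule.mem_span_insert.mp hw
    obtain ⟨l, rfl⟩ := (Submodule.mem_span_range_iff_exists_fun D).mp hz
    refine ⟨a, l, b, hb, fun k => ?_⟩
    have := congrFun h k
    simpa using this.symm
  choose a l b hb h using hexp
  set q := Ideal.Quotient.mk (Ideal.span {c}) with hq
  obtain ⟨s, t, hst, heq⟩ := exists_lt_map_eq fun (m : ℕ) (i : ι) =>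
    (q (a m i), fun j => q (l m i j))
  -- The shifts by `s` and by `t` agree modulo `c`; translating back by `s` compares the shift by
  -- `t - s` with the identity.
  refine ⟨t - s, Nat.sub_pos_of_lt hst, fun i => ?_⟩
  have heq := congrFun heq i
  rw [Prod.mk.injEq] at heq
  have ha := heq.1
  have hl : ∀ j, c ∣ l t i j - l s i j := fun j => by
    have := congrFun heq.2 j
    rwa [eq_comm, Ideal.Quotient.eq, Ideal.mem_span_singleton] at this
  rw [eq_comm, Ideal.Quotient.eq, Ideal.mem_span_singleton] at ha
  obtain ⟨a', ha'⟩ := ha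
  choose l' hl' using hl
  refine ⟨reindex D (· - (s : ℤ)) (algebraMap D _ a' + ∑ j, l' j • y j + (b t i - b s i)),
    hy.sub_mem (add_mem (add_mem (Subalgebra.algebraMap_mem _ _)
      (sum_mem fun j _ => Subalgebra.smul_mem _ (Algebra.subset_adjoin (Set.mem_range_self j)) _))
      (sub_mem (hb t i) (hb s i))) s, fun k => ?_⟩
  have h1 := h t i (k - s)
  have h2 := h s i (k - s)
  rw [sub_add_cancel] at h2
  rw [Nat.cast_sub hst.le, show k + ((t : ℤ) - s) = k - s + t by ring, h1, h2]
  simp only [reindex_apply, Pi.add_apply, Pi.sub_apply, Finset.sum_apply, Pi.smul_apply,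
    smul_eq_mul, Pi.algebraMap_apply, Algebra.algebraMap_self, RingHom.id_apply]
  have hsum : ∑ j, l t i j * y j (k - s) - ∑ j, l s i j * y j (k - s) =
      c * ∑ j, l' j * y j (k - s) := by
    rw [← Finset.sum_sub_distrib, Finset.mul_sum]
    refine Finset.sum_congr rfl fun j _ => ?_
    linear_combination y j (k - s) * hl' j
  linear_combination ha' + hsum

/-- If the shift fixes the generators `z i` modulo `c`, it fixes every polynomial expression in `z`
modulo `c`. -/
theorem dvd_shift_sub {z : ι → ℤ → D}
    (hz : IsShiftStable z) (h : ∀ i, ∃ b ∈ Algebra.adjoin D (Set.range z),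
      ∀ k, z i (k + 1) - z i k = c * b k) {f : ℤ → D}
    (hf : f ∈ Algebra.adjoin D (Set.range z)) :
    ∃ b ∈ Algebra.adjoin D (Set.range z), ∀ k, f (k + 1) - f k = c * b k := by
  induction hf using Algebra.adjoin_induction with
  | mem _ hx => obtain ⟨i, rfl⟩ := hx; exact h i
  | algebraMap r => exact ⟨0, zero_mem _, fun k => by simp⟩
  | add x y _ _ hx hy =>
    obtain ⟨b, hb, h⟩ := hx
    obtain ⟨b', hb', h'⟩ := hy
    refine ⟨b + b', add_mem hb hb', fun k => ?_⟩
    simp only [Pi.add_apply]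
    linear_combination h k + h' k
  | mul x y hx0 hy0 hx hy =>
    obtain ⟨b, hb, h⟩ := hx
    obtain ⟨b', hb', h'⟩ := hy
    refine ⟨reindex D (· + 1) x * b' + b * y,
      add_mem (mul_mem (by exact_mod_cast hz.add_mem hx0 1) hb') (mul_mem hb hy0), fun k => ?_⟩
    simp only [Pi.mul_apply, Pi.add_apply, reindex_apply]
    linear_combination x (k + 1) * h' k + y k * h k

end Congruence

/-! ### Zeros of sequences with highly divisible differences -/

section Dichotomy

variable {D : Type*} [CommRing D] {p : ℕ} [hp : Fact p.Prime] (φ : D →+* PadicAlgCl p)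

/-- If differencing in steps of `e` makes the members of `B` divisible by `p`, then `j`-fold
differencing makes them divisible by `p ^ j`, so their zeros along `m, m + e, m + 2 * e, …` are
finite in number or exhaust this sequence. -/
theorem zeros_finite_or_forall (h2 : p ≠ 2) (hφ : Function.Injective φ) (hφ1 : ∀ x, ‖φ x‖ ≤ 1)
    {B : Set (ℤ → D)} {e : ℤ} (hB : ∀ f ∈ B, ∃ g ∈ B, ∀ k, f (k + e) - f k = p * g k)
    {f : ℤ → D} (hf : f ∈ B) (m : ℤ) :
    (∀ k : ℕ, f (m + e * k) = 0) ∨ {k : ℕ | f (m + e * k) = 0}.Finite := by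
  have hdiff : ∀ j : ℕ, ∃ g ∈ B, (fwdDiff 1)^[j] (fun k : ℕ => φ (f (m + e * k))) =
      fun k : ℕ => (p : PadicAlgCl p) ^ j * φ (g (m + e * k)) := by
    intro j
    induction j with
    | zero => exact ⟨f, hf, by ext k; simp⟩
    | succ j ih =>
      obtain ⟨g, hg, hj⟩ := ih
      obtain ⟨g', hg', h⟩ := hB g hg
      refine ⟨g', hg', ?_⟩
      rw [Function.iterate_succ_apply', hj]
      ext k
      have hk := congrArg φ (h (m + e * k))
      rw [map_sub, map_mul, map_natCast] at hk
      rw [fwdDiff, show m + e * ((k + 1 : ℕ) : ℤ) = m + e * k + e by push_cast; ring]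
      linear_combination (p : PadicAlgCl p) ^ j * hk
  have := finite_zeros_nat p h2 (fun k : ℕ => φ (f (m + e * k))) fun j => by
    obtain ⟨g, -, hj⟩ := hdiff j
    rw [hj, norm_mul, norm_pow]
    exact mul_le_of_le_one_right (by positivity) (hφ1 _)
  simpa only [map_eq_zero_iff φ hφ] using this

theorem zeros_finite_or_univ (h2 : p ≠ 2) (hφ : Function.Injective φ) (hφ1 : ∀ x, ‖φ x‖ ≤ 1)
    {B : Set (ℤ → D)} (hB : ∀ f ∈ B, ∃ g ∈ B, ∀ k, f (k + 1) - f k = p * g k)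
    (hB' : ∀ f ∈ B, ∃ g ∈ B, ∀ k, f (k + -1) - f k = p * g k)
    {f : ℤ → D} (hf : f ∈ B) :
    (∀ k, f k = 0) ∨ {k | f k = 0}.Finite := by
  have up : ∀ m, (∀ k, m ≤ k → f k = 0) ∨ ({k | f k = 0} ∩ Set.Ici m).Finite := by
    intro m
    rcases zeros_finite_or_forall φ h2 hφ hφ1 hB hf m with h | h
    · left
      intro k hk
      obtain ⟨l, rfl⟩ := Int.le.dest hk
      simpa using h l
    · right
      refine (h.image fun l : ℕ => m + 1 * (l : ℤ)).subset ?_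
      rintro k ⟨hk, hmk⟩
      obtain ⟨l, rfl⟩ := Int.le.dest hmk
      refine ⟨l, ?_, by simp⟩
      simpa using hk
  have down : ∀ m, (∀ k, k ≤ m → f k = 0) ∨ ({k | f k = 0} ∩ Set.Iic m).Finite := by
    intro m
    rcases zeros_finite_or_forall φ h2 hφ hφ1 hB' hf m with h | h
    · left
      intro k hk
      obtain ⟨l, rfl⟩ := Int.le.dest hk
      simpa using h l
    · right
      refine (h.image fun l : ℕ => m + -1 * (l : ℤ)).subset ?_
      rintro k ⟨hk, hmk⟩
      obtain ⟨l, rfl⟩ := Int.le.dest hmk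
      refine ⟨l, ?_, by simp⟩
      simpa using hk
  by_cases h : ∃ m, (({k | f k = 0} ∩ Set.Ici m).Finite ∧ ({k | f k = 0} ∩ Set.Iic m).Finite)
  · obtain ⟨m, h1, h2⟩ := h
    right
    refine (h1.union h2).subset fun k hk => ?_
    rcases le_total m k with hmk | hmk
    exacts [Or.inl ⟨hk, hmk⟩, Or.inr ⟨hk, hmk⟩]
  · push Not at h
    left
    intro k
    -- Infinitely many zeros lie on one side of `k`, and `k` belongs to the corresponding ray.
    rcases up k with h1 | h1
    · exact h1 k le_rfl
    rcases down k with h2 | h2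
    · exact h2 k le_rfl
    exact absurd h2 (h k h1)

/-- The zeros common to a set of polynomial expressions in a shift-stable tuple form a union of
progressions and a finite set, if the coefficient ring has finite quotient modulo `p` and embeds in
the unit ball of an algebraic closure of `ℚ_[p]`, with `p` odd. -/
theorem IsShiftStable.isProgressionUnion {ι : Type*} [Finite ι] {u : ι → ℤ → D}
    (hu : IsShiftStable u) [Finite (D ⧸ Ideal.span {(p : D)})] (h2 : p ≠ 2)
    (hφ : Function.Injective φ) (hφ1 : ∀ x, ‖φ x‖ ≤ 1) (F : Set (ℤ → D))
    (hF : ∀ f ∈ F, f ∈ Algebra.adjoin D (Set.range u)) :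
    IsProgressionUnion {m | ∀ f ∈ F, f m = 0} := by
  have hreg : IsLeftRegular (p : D) := by
    intro x y hxy
    apply hφ
    have := congrArg φ hxy
    simp only [map_mul, map_natCast] at this
    exact mul_left_cancel₀ (by exact_mod_cast hp.out.ne_zero) this
  obtain ⟨N, hN, hper⟩ := hu.exists_period (c := (p : D))
  refine isProgressionUnion_of_residues hN fun r => ?_
  -- On the residue class of `r` the sequence is constant modulo `p`: write it as `v 0 + p * y`.
  set v : ι → ℤ → D := fun i => reindex D (fun k => r + N * k) (u i) with hv
  have hvs : IsShiftStable v := hu.residue r N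
  have hvp : ∀ i k, (p : D) ∣ v i k - v i 0 := by
    intro i k
    simp only [hv, reindex_apply]
    induction k using Int.induction_on with
    | zero => simp
    | succ k ih =>
      have := dvd_add (hper i (r + N * k)) ih
      rwa [sub_add_sub_cancel, show r + (N : ℤ) * k + N = r + N * (k + 1) by ring] at this
    | pred k ih =>
      have := dvd_sub ih (hper i (r + N * (-k - 1)))
      rw [show r + (N : ℤ) * (-k - 1) + N = r + N * -k by ring] at this
      convert this using 1
      ring
  choose y hy using hvp
  have hvy : ∀ i k, v i k = v i 0 + p * y i k := fun i k => by rw [← hy]; ring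
  have hyS := fun i => reindex_mem_affineMod hreg hvy (hvs i).1
  have hys : IsShiftStable y := fun i =>
    ⟨affineMod_le_adjoin (hyS i), affineMod_le_adjoin (reindex_mem_affineMod hreg hvy (hvs i).2)⟩
  obtain ⟨M, hM, hMy⟩ := exists_shift_sub_mem hys hyS
  refine isProgressionUnion_of_residues hM fun s => ?_
  set z : ι → ℤ → D := fun i => reindex D (fun k => s + M * k) (y i) with hz
  have hzs : IsShiftStable z := hys.residue s M
  have hzp : ∀ i, ∃ b ∈ Algebra.adjoin D (Set.range z), ∀ k, z i (k + 1) - z i k = p * b k := by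
    intro i
    obtain ⟨b, hb, h⟩ := hMy i
    refine ⟨_, reindex_mem_adjoin (fun k => s + M * k) hb, fun k => ?_⟩
    have := h (s + M * k)
    rwa [show s + (M : ℤ) * k + M = s + M * (k + 1) by ring] at this
  have hB : ∀ f ∈ (Algebra.adjoin D (Set.range z) : Set (ℤ → D)),
      ∃ g ∈ (Algebra.adjoin D (Set.range z) : Set (ℤ → D)), ∀ k, f (k + 1) - f k = p * g k :=
    fun f hf => dvd_shift_sub hzs hzp hf
  have hB' : ∀ f ∈ (Algebra.adjoin D (Set.range z) : Set (ℤ → D)),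
      ∃ g ∈ (Algebra.adjoin D (Set.range z) : Set (ℤ → D)), ∀ k, f (k + -1) - f k = p * g k := by
    intro f hf
    obtain ⟨g, hg, h⟩ := hB f hf
    refine ⟨-reindex D (· - 1) g, neg_mem (by exact_mod_cast hzs.sub_mem hg 1), fun k => ?_⟩
    have := h (k - 1)
    rw [sub_add_cancel] at this
    simp only [Pi.neg_apply, reindex_apply, ← sub_eq_add_neg]
    linear_combination -this
  have hFz : ∀ f ∈ F, (fun k : ℤ => f (r + N * (s + M * k))) ∈
      Algebra.adjoin D (Set.range z) := by
    intro f hf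
    have hfv := reindex_mem_adjoin (fun k => r + N * k) (hF f hf)
    refine mem_adjoin_of_algHom (reindex D fun k => s + M * k) (fun i => ?_) hfv
    have hi : z i ∈ Algebra.adjoin D (Set.range z) := Algebra.subset_adjoin ⟨i, rfl⟩
    convert (Algebra.adjoin D (Set.range z)).add_mem
      (Subalgebra.algebraMap_mem _ (v i 0)) (Subalgebra.smul_mem _ hi (p : D)) using 1
    ext k
    exact hvy i (s + M * k)
  by_cases hall : ∀ f ∈ F, ∀ k : ℤ, f (r + N * (s + M * k)) = 0
  · convert isProgressionUnion_univ using 1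
    exact Set.eq_univ_of_forall fun k f hf => hall f hf k
  · push Not at hall
    obtain ⟨f, hf, k, hk⟩ := hall
    refine isProgressionUnion_of_finite
      (((zeros_finite_or_univ φ h2 hφ hφ1 hB hB' (hFz f hf)).resolve_left
        fun h => hk (h k)).subset fun l hl => hl f hf)

end Dichotomy

/-! ### Embedding finitely generated domains in the integral closure of the `p`-adic integers -/

section Embedding

/-- `ℤ_[p]` has infinite transcendence degree, being uncountable. -/
theorem exists_algebraicIndependent_padicInt (p : ℕ) [hp : Fact p.Prime] (ι : Type*) [Finite ι] :
    ∃ w : ι → ℤ_[p], AlgebraicIndependent ℤ w := by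
  obtain ⟨s, hs⟩ := exists_isTranscendenceBasis ℤ ℤ_[p]
  have hinf : Infinite s := by
    by_contra hfin
    rw [not_infinite_iff_finite] at hfin
    have halg := hs.isAlgebraic
    have hcount : Cardinal.mk (Algebra.adjoin ℤ (Set.range ((↑) : s → ℤ_[p]))) ≤
        Cardinal.aleph0 := by
      rw [← Cardinal.mk_congr hs.1.aevalEquiv.toEquiv]
      refine MvPolynomial.cardinalMk_le_max_lift.trans ?_
      simp
    have h1 : Cardinal.mk ℤ_[p] ≤ Cardinal.aleph0 :=
      (Algebra.IsAlgebraic.cardinalMk_le_max _ _).trans (max_le hcount le_rfl)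
    have h2 : Cardinal.mk ℚ_[p] ≤ Cardinal.mk ℤ_[p] :=
      IsLocalization.cardinalMk_le (L := ℚ_[p]) (nonZeroDivisors ℤ_[p])
    exact absurd ((continuum_le_cardinal_of_nontriviallyNormedField ℚ_[p]).trans (h2.trans h1))
      (not_le.mpr Cardinal.aleph0_lt_continuum)
  obtain ⟨n, ⟨e⟩⟩ := Finite.exists_equiv_fin ι
  let g : ι ↪ s := e.toEmbedding.trans (Fin.valEmbedding.trans (Infinite.natEmbedding s))
  exact ⟨_, hs.1.comp g g.injective⟩

/-- Algebraically independent `p`-adic integers exist in every residue class modulo `p`. -/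
theorem exists_algebraicIndependent_toZMod_eq (p : ℕ) [hp : Fact p.Prime] {ι : Type*} [Finite ι]
    (a : ι → ℤ) :
    ∃ w : ι → ℤ_[p], AlgebraicIndependent ℤ w ∧ ∀ i, PadicInt.toZMod (w i) = a i := by
  obtain ⟨w, hw⟩ := exists_algebraicIndependent_padicInt p ι
  refine ⟨_, hw.polynomial_aeval_of_transcendental
    (f := fun i => Polynomial.C (a i) + Polynomial.C (p : ℤ) * Polynomial.X)
    fun i => ?_, fun i => ?_⟩
  · have hp0 : (p : ℤ) ≠ 0 := by exact_mod_cast hp.out.ne_zero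
    have hd : (Polynomial.C (a i) + Polynomial.C (p : ℤ) * Polynomial.X).natDegree = 1 := by
      rw [add_comm]
      exact Polynomial.natDegree_linear hp0
    refine Polynomial.transcendental _ (by rw [hd]; exact one_ne_zero)
      (mem_nonZeroDivisors_of_ne_zero ?_)
    rw [Polynomial.leadingCoeff_ne_zero]
    exact Polynomial.ne_zero_of_natDegree_gt (n := 0) (by rw [hd]; exact one_pos)
  · simp

/-- An embedding `ψ : A → ℤ_[p]` of a domain extends to every domain `R` algebraic over `A`. If `ψ s`
is a unit, the extension sends the elements of `R` which become integral over `A` after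
multiplication by `s` to elements integral over `ℤ_[p]`. -/
theorem exists_extension_of_isAlgebraic {p : ℕ} [hp : Fact p.Prime] {A R : Type*} [CommRing A]
    [IsDomain A] [CommRing R] [IsDomain R] [Algebra A R] [Module.IsTorsionFree A R]
    [hAR : Algebra.IsAlgebraic A R] (ψ : A →+* ℤ_[p]) (hψ : Function.Injective ψ) {s : A}
    (hs : IsUnit (ψ s)) :
    ∃ f : R →+* PadicAlgCl p, Function.Injective f ∧
      ∀ x, IsIntegral A (s • x) → IsIntegral ℤ_[p] (f x) := by
  let _ : Algebra A ℤ_[p] := ψ.toAlgebra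
  let _ : Algebra A (PadicAlgCl p) := ((algebraMap ℤ_[p] (PadicAlgCl p)).comp ψ).toAlgebra
  have : IsScalarTower A ℤ_[p] (PadicAlgCl p) := IsScalarTower.of_algebraMap_eq fun _ => rfl
  have hinj' : Function.Injective (algebraMap ℤ_[p] (PadicAlgCl p)) := by
    rw [IsScalarTower.algebraMap_eq ℤ_[p] ℚ_[p] (PadicAlgCl p)]
    exact (algebraMap ℚ_[p] (PadicAlgCl p)).injective.comp (IsFractionRing.injective ℤ_[p] ℚ_[p])
  have hinj : Function.Injective (algebraMap A (PadicAlgCl p)) := hinj'.comp hψ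
  have : FaithfulSMul A (PadicAlgCl p) := (faithfulSMul_iff_algebraMap_injective _ _).mpr hinj
  have : Module.IsTorsionFree A (PadicAlgCl p) := inferInstance
  let f : R →ₐ[A] PadicAlgCl p := IsAlgClosed.lift
  refine ⟨f, ?_, fun x hx => ?_⟩
  · rw [injective_iff_map_eq_zero]
    intro x hx
    by_contra hx0
    refine Ideal.comap_ne_bot_of_algebraic_mem (R := A) (I := RingHom.ker f) hx0 hx
      (hAR.isAlgebraic x) ((Submodule.eq_bot_iff _).mpr fun y hy => ?_)
    have hy : f (algebraMap A R y) = 0 := hy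
    rw [f.commutes] at hy
    exact (map_eq_zero_iff _ hinj).mp hy
  · have h1 : IsIntegral ℤ_[p] (f (s • x)) := (hx.map f).tower_top
    obtain ⟨b, hb⟩ := hs.exists_left_inv
    have h2 : f x = algebraMap ℤ_[p] (PadicAlgCl p) b * f (s • x) := by
      rw [map_smul, Algebra.smul_def, ← mul_assoc]
      change _ = algebraMap ℤ_[p] (PadicAlgCl p) b * algebraMap ℤ_[p] (PadicAlgCl p) (ψ s) * _
      rw [← map_mul, hb, map_one, one_mul]
    change IsIntegral ℤ_[p] (f x)
    rw [h2]
    exact isIntegral_algebraMap.mul h1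

/-- A finitely generated domain of characteristic zero embeds in the integral closure of `ℤ_[p]`
in an algebraic closure of `ℚ_[p]`, for some odd `p`. A transcendence basis is sent to algebraically
independent `p`-adic integers whose residues are chosen so that the common denominator of the
generators becomes a unit. -/
theorem exists_padic_embedding {K : Type*} [Field K] [CharZero K] (S : Finset K) :
    ∃ (p : ℕ) (_ : Fact p.Prime), p ≠ 2 ∧
      ∃ φ : Algebra.adjoin ℤ (S : Set K) →+* PadicAlgCl p, Function.Injective φ ∧
        ∀ x : Algebra.adjoin ℤ (S : Set K), (x : K) ∈ S → IsIntegral ℤ_[p] (φ x) := by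
  classical
  set R := Algebra.adjoin ℤ (S : Set K) with hR
  set gens : Set R := (↑) ⁻¹' (S : Set K) with hgens
  have hgf : gens.Finite := S.finite_toSet.preimage Subtype.val_injective.injOn
  have htop : Algebra.adjoin ℤ gens = ⊤ := Algebra.adjoin_adjoin_coe_preimage
  have halg : Algebra.IsAlgebraic (Algebra.adjoin ℤ gens) R := by
    constructor
    intro x
    exact isAlgebraic_algebraMap (⟨x, htop ▸ Algebra.mem_top⟩ : Algebra.adjoin ℤ gens)
  obtain ⟨t, htg, ht⟩ := exists_isTranscendenceBasis_subset (R := ℤ) gens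
  have htf : Finite t := hgf.subset htg
  set A := Algebra.adjoin ℤ (Set.range ((↑) : t → R)) with hA
  have hAR : Algebra.IsAlgebraic A R := ht.isAlgebraic
  obtain ⟨s, hs0, hs⟩ := Algebra.IsAlgebraic.exists_integral_multiples (R := A) hgf.toFinset
  set σ : MvPolynomial t ℤ := ht.1.aevalEquiv.symm s with hσ
  have hσ0 : σ ≠ 0 := by simpa [hσ] using hs0
  obtain ⟨a, ha⟩ : ∃ a : t → ℤ, MvPolynomial.eval a σ ≠ 0 := by
    by_contra! h
    exact hσ0 (MvPolynomial.funext fun a => by simpa using h a)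
  -- A prime this large is odd and does not divide the nonzero integer `σ(a)`.
  obtain ⟨p, hple, hp⟩ := Nat.exists_infinite_primes (3 + (MvPolynomial.eval a σ).natAbs)
  have hpf : Fact p.Prime := ⟨hp⟩
  refine ⟨p, hpf, by omega, ?_⟩
  obtain ⟨w, hw, hwa⟩ := exists_algebraicIndependent_toZMod_eq p a
  set ψ : A →+* ℤ_[p] :=
    ((MvPolynomial.aeval w).comp ht.1.aevalEquiv.symm.toAlgHom : A →ₐ[ℤ] ℤ_[p]).toRingHom with hψ
  have hψi : Function.Injective ψ :=
    (show Function.Injective (MvPolynomial.aeval w : _ →ₐ[ℤ] ℤ_[p]) from hw).comp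
      ht.1.aevalEquiv.symm.injective
  have hunit : IsUnit (ψ s) := by
    have h1 : PadicInt.toZMod (ψ s) = ((MvPolynomial.eval a σ : ℤ) : ZMod p) := by
      have hhom : (PadicInt.toZMod (p := p)).comp (MvPolynomial.aeval w).toRingHom =
          (Int.castRingHom (ZMod p)).comp (MvPolynomial.eval a) :=
        MvPolynomial.ringHom_ext (fun m => by simp) fun i => by simpa using hwa i
      exact congrArg (fun g : MvPolynomial t ℤ →+* ZMod p => g σ) hhom
    by_contra hnu
    have hmem : ψ s ∈ IsLocalRing.maximalIdeal ℤ_[p] := hnu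
    rw [← PadicInt.ker_toZMod, RingHom.mem_ker, h1, ZMod.intCast_zmod_eq_zero_iff_dvd] at hmem
    have := Nat.le_of_dvd (Int.natAbs_pos.mpr ha) (Int.natCast_dvd.mp hmem)
    omega
  obtain ⟨f, hf, hfs⟩ := exists_extension_of_isAlgebraic ψ hψi (R := R) hunit
  exact ⟨f, hf, fun x hx => hfs x (hs x (hgf.mem_toFinset.mpr hx))⟩

theorem norm_le_one_of_isIntegral {p : ℕ} [hp : Fact p.Prime] {x : PadicAlgCl p}
    (hx : IsIntegral ℤ_[p] x) : ‖x‖ ≤ 1 := by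
  have hx' : IsIntegral ℚ_[p] x := hx.tower_top
  rw [← PadicAlgCl.spectralNorm_eq, spectralNorm, spectralValue_le_one_iff (minpoly.monic hx'),
    minpoly.isIntegrallyClosed_eq_field_fractions' ℚ_[p] hx]
  intro n
  rw [Polynomial.coeff_map]
  exact PadicInt.norm_le_one _

theorem finite_quotient_span_p {p : ℕ} [hp : Fact p.Prime] (D : Type*) [CommRing D]
    [Algebra ℤ_[p] D] [Module.Finite ℤ_[p] D] : Finite (D ⧸ Ideal.span {(p : D)}) := by
  set I : Ideal D := Ideal.span {(p : D)} with hI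
  set J : Ideal ℤ_[p] := Ideal.under ℤ_[p] I with hJ
  have hle : IsLocalRing.maximalIdeal ℤ_[p] ≤ J := by
    rw [PadicInt.maximalIdeal_eq_span_p, Ideal.span_singleton_le_iff_mem]
    change algebraMap ℤ_[p] D p ∈ I
    rw [map_natCast]
    exact Ideal.mem_span_singleton_self _
  have : Finite (ℤ_[p] ⧸ IsLocalRing.maximalIdeal ℤ_[p]) :=
    Finite.of_equiv (ZMod p) PadicInt.residueField.symm.toEquiv
  have : Finite (ℤ_[p] ⧸ J) :=
    Finite.of_surjective (Ideal.Quotient.factor hle) (Ideal.Quotient.factor_surjective hle)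
  have : Module.Finite (ℤ_[p] ⧸ J) (D ⧸ I) := Module.Finite.of_restrictScalars_finite ℤ_[p] _ _
  exact Module.finite_of_finite (ℤ_[p] ⧸ J)

end Embedding

/-! ### Descent of the orbit to a `p`-adic ring -/

section Descent

/-- Polynomial expressions, with coefficients in `R`, in a tuple of sequences over `R` are carried by
a ring homomorphism to polynomial expressions in the image of the tuple. -/
theorem comp_eval_mem_adjoin {R D : Type*} [CommRing R] [CommRing D] (φ : R →+* D) {ι : Type*}
    (x : ℤ → ι → R) (P : MvPolynomial ι R) :
    (fun m => φ (MvPolynomial.eval (x m) P)) ∈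
      Algebra.adjoin D (Set.range fun (i : ι) (m : ℤ) => φ (x m i)) := by
  induction P using MvPolynomial.induction_on with
  | C a =>
    simp only [MvPolynomial.eval_C]
    exact Subalgebra.algebraMap_mem _ (φ a)
  | add P Q hP hQ =>
    simp only [map_add]
    exact add_mem hP hQ
  | mul_X P i hP =>
    simp only [map_mul, MvPolynomial.eval_X]
    exact mul_mem hP (Algebra.subset_adjoin ⟨i, rfl⟩)

/-- Zeros of polynomials along a two-sided orbit of polynomial maps that are inverse to each other
on the orbit. -/
theorem isProgressionUnion_of_recurrence {K : Type*} [Field K] [CharZero K] {n : ℕ}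
    (F G : Fin n → MvPolynomial (Fin n) K) (u : ℤ → Fin n → K)
    (hF : ∀ m i, u (m + 1) i = MvPolynomial.eval (u m) (F i))
    (hG : ∀ m i, u (m - 1) i = MvPolynomial.eval (u m) (G i))
    (s : Finset (MvPolynomial (Fin n) K)) :
    IsProgressionUnion {m | ∀ P ∈ s, MvPolynomial.eval (u m) P = 0} := by
  classical
  -- All the data are defined over the subring generated by the finite set `S`.
  set S : Finset K := Finset.univ.biUnion (fun i => (F i).coeffs) ∪
    Finset.univ.biUnion (fun i => (G i).coeffs) ∪ s.biUnion (fun P => P.coeffs) ∪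
    Finset.univ.image (u 0) with hS
  obtain ⟨p, hp, h2, h⟩ := exists_padic_embedding S
  set R := Algebra.adjoin ℤ (S : Set K) with hR
  obtain ⟨φ, hφ, hφint⟩ := h
  have hSR : ∀ x ∈ S, x ∈ R := fun x hx => Algebra.subset_adjoin hx
  have lift : ∀ P : MvPolynomial (Fin n) K, P.coeffs ⊆ S →
      ∃ Q : MvPolynomial (Fin n) R, MvPolynomial.map (algebraMap R K) Q = P := by
    intro P hP
    refine MvPolynomial.mem_range_map_iff_coeffs_subset.mpr fun x hx => ?_
    exact ⟨⟨x, hSR x (hP hx)⟩, rfl⟩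
  have hFS : ∀ i, (F i).coeffs ⊆ S := fun i x hx => by
    simp only [hS, Finset.mem_union, Finset.mem_biUnion]
    exact Or.inl (Or.inl (Or.inl ⟨i, Finset.mem_univ i, hx⟩))
  have hGS : ∀ i, (G i).coeffs ⊆ S := fun i x hx => by
    simp only [hS, Finset.mem_union, Finset.mem_biUnion]
    exact Or.inl (Or.inl (Or.inr ⟨i, Finset.mem_univ i, hx⟩))
  have hsS : ∀ P ∈ s, P.coeffs ⊆ S := fun P hP x hx => by
    simp only [hS, Finset.mem_union, Finset.mem_biUnion]
    exact Or.inl (Or.inr ⟨P, hP, hx⟩)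
  choose F' hF' using fun i => lift (F i) (hFS i)
  choose G' hG' using fun i => lift (G i) (hGS i)
  choose L hL using fun P : s => lift P (hsS P P.2)
  have hev : ∀ (x : Fin n → R) (Q : MvPolynomial (Fin n) R),
      MvPolynomial.eval (fun i => (x i : K)) (MvPolynomial.map (algebraMap R K) Q) =
        (MvPolynomial.eval x Q : R) := by
    intro x Q
    rw [MvPolynomial.eval_map]
    exact (MvPolynomial.eval₂_comp_left (algebraMap R K) (RingHom.id R) x Q).symm
  have hu : ∀ m : ℤ, ∃ x : Fin n → R, ∀ i, (x i : K) = u m i := by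
    intro m
    induction m using Int.induction_on with
    | zero =>
      exact ⟨fun i => ⟨u 0 i, hSR _ (Finset.mem_union_right _
        (Finset.mem_image_of_mem _ (Finset.mem_univ i)))⟩, fun i => rfl⟩
    | succ m ih =>
      obtain ⟨x, hx⟩ := ih
      refine ⟨fun i => MvPolynomial.eval x (F' i), fun i => ?_⟩
      rw [← hev, hF', hF, funext hx]
    | pred m ih =>
      obtain ⟨x, hx⟩ := ih
      refine ⟨fun i => MvPolynomial.eval x (G' i), fun i => ?_⟩
      rw [← hev, hG', hG, funext hx]
  choose x hx using hu
  have hxu : ∀ m, (fun i => (x m i : K)) = u m := fun m => funext (hx m)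
  have hFx : ∀ m i, x (m + 1) i = MvPolynomial.eval (x m) (F' i) := fun m i =>
    Subtype.val_injective (by rw [hx, ← hev, hF', hF, hxu])
  have hGx : ∀ m i, x (m - 1) i = MvPolynomial.eval (x m) (G' i) := fun m i =>
    Subtype.val_injective (by rw [hx, ← hev, hG', hG, hxu])
  -- The image of the subring lies in a finite `ℤ_[p]`-algebra.
  set gens : Set (PadicAlgCl p) := φ '' ((↑) ⁻¹' (S : Set K)) with hgens
  have hgf : gens.Finite := (S.finite_toSet.preimage Subtype.val_injective.injOn).image φ
  set D := Algebra.adjoin ℤ_[p] gens with hD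
  have hgi : ∀ y ∈ gens, IsIntegral ℤ_[p] y := by
    rintro _ ⟨y, hy, rfl⟩
    exact hφint y hy
  have hDfin : Module.Finite ℤ_[p] D := Module.Finite.of_fg (fg_adjoin_of_finite hgf hgi)
  have hφD : ∀ y : R, φ y ∈ D.toSubring := by
    have htop : Algebra.adjoin ℤ ((↑) ⁻¹' (S : Set K) : Set R) = ⊤ :=
      Algebra.adjoin_adjoin_coe_preimage
    intro y
    have hy : y ∈ Algebra.adjoin ℤ ((↑) ⁻¹' (S : Set K) : Set R) := htop ▸ Algebra.mem_top
    induction hy using Algebra.adjoin_induction with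
    | mem y hy => exact Algebra.subset_adjoin ⟨y, hy, rfl⟩
    | algebraMap m =>
      rw [eq_intCast, map_intCast]
      exact intCast_mem _ m
    | add y z _ _ hy hz => rw [map_add]; exact add_mem hy hz
    | mul y z _ _ hy hz => rw [map_mul]; exact mul_mem hy hz
  let φ' : R →+* D := φ.codRestrict D.toSubring hφD
  have hφ' : Function.Injective φ' := fun a b h => hφ (congrArg Subtype.val h)
  have hquot : Finite (D ⧸ Ideal.span {(p : D)}) := finite_quotient_span_p D
  have hnorm : ∀ y : D, ‖D.toSubring.subtype y‖ ≤ 1 := fun y =>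
    norm_le_one_of_isIntegral ((Algebra.IsIntegral.isIntegral (R := ℤ_[p]) y).map D.val)
  have hstable : IsShiftStable fun (i : Fin n) (m : ℤ) => φ' (x m i) := by
    intro i
    constructor
    · convert comp_eval_mem_adjoin φ' x (F' i) using 1
      ext m
      simp only [reindex_apply, hFx]
    · convert comp_eval_mem_adjoin φ' x (G' i) using 1
      ext m
      simp only [reindex_apply, hGx]
  have hfinal := hstable.isProgressionUnion D.toSubring.subtype h2 Subtype.val_injective hnorm
    (Set.range fun (P : s) (m : ℤ) => φ' (MvPolynomial.eval (x m) (L P))) (by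
      rintro _ ⟨P, rfl⟩
      exact comp_eval_mem_adjoin φ' x (L P))
  convert hfinal using 1
  ext m
  simp only [Set.mem_ofPred_eq, Set.forall_mem_range, Subtype.forall]
  refine forall₂_congr fun P hP => ?_
  have hP' : MvPolynomial.eval (fun i => (x m i : K)) P =
      (MvPolynomial.eval (x m) (L ⟨P, hP⟩) : R) := by
    rw [← hev]
    exact congrArg _ (hL ⟨P, hP⟩).symm
  rw [map_eq_zero_iff φ' hφ', ← hxu m, hP']
  exact ZeroMemClass.coe_eq_zero

end Descent

end AffineOrbit

theorem mainTheorem1 {K : Type*} [Field K] [CharZero K] {n : ℕ}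
    (Y : Set (Fin n → K)) (hY : AffineOrbit.IsAffineVariety Y)
    (σ : Equiv.Perm Y) (hσ : AffineOrbit.IsAutomorphism σ)
    (q : Y)
    (X : Set (Fin n → K)) (hX : AffineOrbit.IsAffineVariety X) (hXY : X ⊆ Y) :
    ∃ (𝒜 : Set (Set ℤ)) (T : Set ℤ),
      𝒜.Finite ∧ (∀ P ∈ 𝒜, AffineOrbit.IsDoublyInfiniteProgression P) ∧ T.Finite ∧
      {m : ℤ | ((σ ^ m) q : Fin n → K) ∈ X} = ⋃₀ 𝒜 ∪ T := by
  obtain ⟨⟨F, hF⟩, ⟨G, hG⟩⟩ := hσ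
  obtain ⟨I, rfl⟩ := hX
  obtain ⟨s, rfl⟩ := IsNoetherian.noetherian I
  have h := AffineOrbit.isProgressionUnion_of_recurrence F G (fun m => ((σ ^ m) q : Fin n → K))
    (fun m i => by rw [← hF, add_comm, zpow_add, zpow_one, Equiv.Perm.mul_apply])
    (fun m i => by
      rw [← hG, sub_eq_neg_add, zpow_add, zpow_neg_one, Equiv.Perm.mul_apply, Equiv.Perm.inv_def]) s
  have hset : {m : ℤ | ((σ ^ m) q : Fin n → K) ∈
      MvPolynomial.zeroLocus K (Ideal.span (s : Set (MvPolynomial (Fin n) K)))} =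
      {m | ∀ P ∈ s, MvPolynomial.eval ((σ ^ m) q : Fin n → K) P = 0} := by
    ext m
    simp only [Set.mem_ofPred_eq, MvPolynomial.zeroLocus_span]
    rfl
  exact hset ▸ h
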